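/- All graphs are finite, simple and undirected (the empty graph is allowed). For graphs $H,G$ let $H(G)$ be the number of (not necessarily induced) subgraphs of $G$ isomorphic to $H$, and let $k(H)$ be the number of connected components of $H$. For a family $\mathcal H$ of graphs, let $\mathbb C\mathcal H$ be the complex vector space of functions on graphs spanned by the functions $G\mapsto H(G)$, $H\in\mathcal H$ (finite linear combinations). A graph polynomial $f$ assigns to every graph $G$ a polynomial $f(G,x)\in\mathbb C[x]$. It is isomorphism-invariant if $f(G_1,x)=f(G_2,x)$ whenever $G_1\cong G_2$; monic if $f(G,x)$ is monic of degree $|V(G)|$ for every $G$; of exponential type if $f(\emptyset,x)=1$ and $\sum_{S\subseteq V(G)} f(G[S],x)\,f(G[V(G)\setminus S],y)=f(G,x+y)$ for every $G$; multiplicative if $f(G_1\uplus G_2,x)=f(G_1,x)f(G_2,x)$ for all $G_1,G_2$, where $\uplus$ denotes disjoint union. Theorem. Let $f$ be an isomorphism-invariant monic graph polynomial of exponential type. Write $f(G,x)=\sum_{k=0}^{n}(-1)^k e_k(G)x^{n-k}$ with $n=|V(G)|$, put $e_k(G)=0$ for $k>n$, and let $p_k(G)$ be the sum of the $k$-th powers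 of the roots of $f(G,x)$ in $\mathbb C$, counted with multiplicity. Let $k\ge 1$. (a) We have $$e_k\in\mathbb C\{H : k+1\le |V(H)|\le 2k,\ |V(H)|-k(H)\le k\}$$ and $$p_k\in\mathbb C\{H : 2\le |V(H)|\le 2k,\ |V(H)|-k(H)\le k\}.$$ (b) If, in addition, $f$ is multiplicative, then $$e_k\in\mathbb C\{H : H \text{ has no isolated points and } |V(H)|-k(H)=k\}$$ and $$p_k\in\mathbb C\{H : H \text{ is connected and } 2\le |V(H)|\le k+1\}.$$ -/

import Mathlib

open Polynomial

universe u

noncomputable section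

/-- A finite simple graph (the empty graph is allowed). -/
structure FinGraph : Type (u + 1) where
  V : Type u
  [fintype : Fintype V]
  graph : SimpleGraph V

namespace FinGraph

instance (G : FinGraph.{u}) : Fintype G.V := G.fintype

/-- `|V(G)|`. -/
def order (G : FinGraph.{u}) : ℕ := Fintype.card G.V

/-- `k(G)`, the number of connected components. -/
def numComponents (G : FinGraph.{u}) : ℕ := Nat.card G.graph.ConnectedComponent

/-- The induced subgraph `G[S]`. -/
def induce (G : FinGraph.{u}) (S : Set G.V) : FinGraph.{u} where
  V := S
  fintype := Fintype.ofFinite S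
  graph := G.graph.induce S

/-- The disjoint union of two graphs. -/
def disjUnion (G₁ G₂ : FinGraph.{u}) : FinGraph.{u} where
  V := G₁.V ⊕ G₂.V
  graph := G₁.graph ⊕g G₂.graph

/-- `H(G)`, the number of (not necessarily induced) subgraphs of `G` isomorphic to `H`. -/
def subgraphCount (H G : FinGraph.{u}) : ℕ := G.graph.copyCount H.graph

/-- The graph has no isolated points. -/
def IsolateFree (G : FinGraph.{u}) : Prop := ∀ v : G.V, ¬ G.graph.IsIsolated v

/-- `ℂ𝓗`: the complex vector space of functions on graphs generated by the subgraph counting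
functions `G ↦ H(G)` with `H ∈ 𝓗`. -/
def countSpan (𝓗 : Set FinGraph.{u}) : Submodule ℂ (FinGraph.{u} → ℂ) :=
  Submodule.span ℂ ((fun H G => (subgraphCount H G : ℂ)) '' 𝓗)

end FinGraph

/-- A graph polynomial assigns to every finite simple graph a polynomial in `ℂ[x]`. -/
abbrev GraphPolynomial : Type (u + 1) := FinGraph.{u} → ℂ[X]

namespace GraphPolynomial

/-- `f(G,x)` is monic of degree `|V(G)|` for all `G`. -/
def IsMonic (f : GraphPolynomial.{u}) : Prop :=
  ∀ G, (f G).Monic ∧ (f G).natDegree = G.order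

def IsoInvariant (f : GraphPolynomial.{u}) : Prop :=
  ∀ G₁ G₂ : FinGraph.{u}, Nonempty (G₁.graph ≃g G₂.graph) → f G₁ = f G₂

/-- `f(∅,x) = 1` and `∑_{S ⊆ V(G)} f(G[S],x) f(G[V(G) ∖ S],y) = f(G,x+y)`. -/
def ExponentialType (f : GraphPolynomial.{u}) : Prop :=
  (∀ G : FinGraph.{u}, IsEmpty G.V → f G = 1) ∧
  ∀ (G : FinGraph.{u}) (x y : ℂ),
    ∑ S : Set G.V, (f (G.induce S)).eval x * (f (G.induce Sᶜ)).eval y = (f G).eval (x + y)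

def Multiplicative (f : GraphPolynomial.{u}) : Prop :=
  ∀ G₁ G₂ : FinGraph.{u}, f (G₁.disjUnion G₂) = f G₁ * f G₂

/-- The numbers `e_k(G)` with `f(G,x) = ∑_{k=0}^n (-1)^k e_k(G) x^{n-k}`, where `n = |V(G)|`,
and `e_k(G) = 0` for `k > n`. -/
def e (f : GraphPolynomial.{u}) (k : ℕ) : FinGraph.{u} → ℂ := fun G =>
  if k ≤ G.order then (-1) ^ k * (f G).coeff (G.order - k) else 0

/-- The `k`-th power sum of the roots of `f(G,x)`, with multiplicity. -/
def p (f : GraphPolynomial.{u}) (k : ℕ) : FinGraph.{u} → ℂ := fun G =>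
  ((f G).roots.map (fun z => z ^ k)).sum

end GraphPolynomial

end

/-! Möbius inversion over subgraphs gives polynomials `core f H` with `f(G) = ∑_K X^(|G|-|K|)
core(K)`, the sum being over the subgraphs `K` of `G`. Write `c_j(H)` for their coefficients. Then
`e_k(G) = (-1)^k ∑_H c_(|H|-k)(H)` over the subgraphs `H` with `|H| ≥ k`, so part (a) for `e_k` is a
statement about where `c_j` is nonzero.

Exponential type becomes a convolution identity (`eval_core_add`): `core(G)(x+y)` is the sum of
`core(K)(x) core(L)(y)` over the splittings of `G` into vertex-disjoint `K`, `L` with union `G`. Its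
linear part in `x` gives `(j+1) c_(j+1)(G) = ∑ c_1(K) c_j(L)`. Monicity forces `|K| ≥ 2` when
`c_1(K) ≠ 0`, so `c_j(H) ≠ 0` implies `|H| ≥ 2j` and `k(H) ≥ j`; with `j = |H| - k` these are the
bounds for `e_k`. If `f` is multiplicative, `c_1` lives on connected graphs, hence `c_j` on graphs
without isolated points and with exactly `j` components.

For `p_k`, Newton's identities reduce to products of subgraph sums. Such a product is a subgraph sum
over unions `K ⊔ L` (`IsSubgraphSum.mul`), and both `|V|` and the rank `|V| - k` are subadditive
under unions. If `f` is multiplicative, `p_k` is additive on disjoint unions, which kills all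
weights on disconnected graphs. -/

noncomputable section

open scoped Classical

/-! ### Transport of subgraphs along injective homomorphisms. -/

namespace SimpleGraph.Subgraph

variable {V W : Type*} {A : SimpleGraph V} {B : SimpleGraph W}

theorem comap_map_of_injective {h : A →g B} (hh : Function.Injective h) (L : A.Subgraph) :
    (L.map h).comap h = L := by
  ext u v
  · simp [hh.eq_iff]
  · simp only [comap_adj, map_adj, Relation.Map]
    constructor
    · rintro ⟨-, a, b, hab, ha, hb⟩
      rwa [← hh ha, ← hh hb]
    · exact fun huv => ⟨L.adj_sub huv, u, v, huv, rfl, rfl⟩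

theorem map_comap_of_le_map_top {h : A →g B} {L : B.Subgraph}
    (hL : L ≤ Subgraph.map h ⊤) : (L.comap h).map h = L := by
  ext u v
  · simp only [map_verts, comap_verts, Set.mem_image, Set.mem_preimage]
    constructor
    · rintro ⟨a, ha, rfl⟩
      exact ha
    · intro hu
      obtain ⟨a, -, rfl⟩ := hL.1 hu
      exact ⟨a, hu, rfl⟩
  · simp only [map_adj, Relation.Map, comap_adj]
    constructor
    · rintro ⟨a, b, ⟨-, hab⟩, rfl, rfl⟩
      exact hab
    · intro huv
      obtain ⟨a, b, hab, rfl, rfl⟩ := hL.2 huv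
      exact ⟨a, b, ⟨hab, huv⟩, rfl, rfl⟩

theorem map_injective_of_injective {h : A →g B} (hh : Function.Injective h) :
    Function.Injective (Subgraph.map h) :=
  Function.LeftInverse.injective (comap_map_of_injective hh)

theorem map_le_map_top (h : A →g B) (L : A.Subgraph) : L.map h ≤ Subgraph.map h ⊤ :=
  map_mono le_top

theorem sum_map_of_injective [Fintype A.Subgraph] [Fintype B.Subgraph] {M : Type*}
    [AddCommMonoid M] {h : A →g B} (hh : Function.Injective h) (φ : B.Subgraph → M) :
    ∑ L : A.Subgraph, φ (L.map h) =
      ∑ L : B.Subgraph with L ≤ Subgraph.map h ⊤, φ L := by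
  refine Finset.sum_bij' (fun L _ => L.map h) (fun L _ => L.comap h) ?_ ?_ ?_ ?_ ?_
  · intro L _
    simpa using map_le_map_top h L
  · simp
  · intro L _
    exact comap_map_of_injective hh L
  · intro L hL
    exact map_comap_of_le_map_top (by simpa using hL)
  · simp

/-- An injective homomorphism restricts to an isomorphism from each subgraph to its image. -/
def isoMapOfInjective {h : A →g B} (hh : Function.Injective h) (L : A.Subgraph) :
    L.coe ≃g (L.map h).coe where
  toEquiv := Equiv.Set.image h L.verts hh
  map_rel_iff' := by
    rintro ⟨a, ha⟩ ⟨b, hb⟩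
    simp only [coe_adj, map_adj, Relation.Map]
    constructor
    · rintro ⟨a', b', hab, h1, h2⟩
      obtain rfl : a' = a := hh h1
      obtain rfl : b' = b := hh h2
      exact hab
    · exact fun hab => ⟨a, b, hab, rfl, rfl⟩

end SimpleGraph.Subgraph

open SimpleGraph

/-! ### Isomorphism, induction on subgraphs, and sums over covering pairs. -/

namespace FinGraph

instance (G : FinGraph.{u}) : Fintype G.graph.Subgraph := Fintype.ofFinite _

/-- A subgraph, regarded as a graph in its own right. -/
def ofSubgraph {G : FinGraph.{u}} (K : G.graph.Subgraph) : FinGraph.{u} where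
  V := K.verts
  fintype := Fintype.ofFinite K.verts
  graph := K.coe

/-- Two finite graphs are isomorphic. -/
def IsIso (G H : FinGraph.{u}) : Prop := Nonempty (G.graph ≃g H.graph)

theorem IsIso.refl (G : FinGraph.{u}) : G.IsIso G := ⟨Iso.refl⟩

theorem IsIso.symm {G H : FinGraph.{u}} : G.IsIso H → H.IsIso G := fun ⟨e⟩ => ⟨e.symm⟩

theorem IsIso.trans {G H K : FinGraph.{u}} : G.IsIso H → H.IsIso K → G.IsIso K :=
  fun ⟨e⟩ ⟨e'⟩ => ⟨e.trans e'⟩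

/-- A function on finite graphs that takes equal values on isomorphic graphs. -/
def Invariant {α : Type*} (c : FinGraph.{u} → α) : Prop :=
  ∀ ⦃G H : FinGraph.{u}⦄, G.IsIso H → c G = c H

theorem order_eq_natCard (G : FinGraph.{u}) : G.order = Nat.card G.V :=
  Fintype.card_eq_nat_card

theorem invariant_order : Invariant order.{u} := fun G H ⟨e⟩ => by
  rw [order_eq_natCard, order_eq_natCard, Nat.card_congr e.toEquiv]

theorem order_ofSubgraph {G : FinGraph.{u}} (K : G.graph.Subgraph) :
    (ofSubgraph K).order = K.verts.ncard := order_eq_natCard _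

theorem order_ofSubgraph_le {G : FinGraph.{u}} (K : G.graph.Subgraph) :
    (ofSubgraph K).order ≤ G.order := by
  rw [order_ofSubgraph, order_eq_natCard]
  exact Set.ncard_le_card _

theorem isIso_ofSubgraph_top (G : FinGraph.{u}) :
    IsIso (ofSubgraph (⊤ : G.graph.Subgraph)) G := ⟨Subgraph.topIso⟩

theorem isIso_ofSubgraph_map {G H : FinGraph.{u}} {h : G.graph →g H.graph}
    (hh : Function.Injective h) (L : G.graph.Subgraph) :
    IsIso (ofSubgraph L) (ofSubgraph (L.map h)) := ⟨Subgraph.isoMapOfInjective hh L⟩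

/-- The inclusion of a subgraph. -/
def inclusion {G : FinGraph.{u}} (K : G.graph.Subgraph) : (ofSubgraph K).graph →g G.graph :=
  K.hom

theorem inclusion_injective {G : FinGraph.{u}} (K : G.graph.Subgraph) :
    Function.Injective (inclusion K) := Subgraph.hom_injective

theorem map_inclusion_top {G : FinGraph.{u}} (K : G.graph.Subgraph) :
    Subgraph.map (inclusion K) ⊤ = K := Subgraph.map_hom_top K

/-- Proper subgraphs have fewer subgraphs. -/
theorem card_subgraph_lt {G : FinGraph.{u}} {K : G.graph.Subgraph} (hK : K ≠ ⊤) :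
    Fintype.card (ofSubgraph K).graph.Subgraph < Fintype.card G.graph.Subgraph := by
  refine Fintype.card_lt_of_injective_of_notMem _
    (Subgraph.map_injective_of_injective (inclusion_injective K)) (b := ⊤) ?_
  rintro ⟨L, hL⟩
  apply hK
  rw [eq_top_iff, ← hL]
  exact (Subgraph.map_le_map_top _ _).trans (map_inclusion_top K).le

/-- Induction on finite graphs along proper subgraphs. -/
theorem subgraph_induction {P : FinGraph.{u} → Prop}
    (ih : ∀ G : FinGraph.{u}, (∀ K : G.graph.Subgraph, K ≠ ⊤ → P (ofSubgraph K)) → P G)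
    (G : FinGraph.{u}) : P G := by
  induction hn : Fintype.card G.graph.Subgraph using Nat.strong_induction_on generalizing G with
  | _ n IH =>
    subst hn
    exact ih G fun K hK => IH _ (card_subgraph_lt hK) _ rfl

section Sums

variable {M : Type*} [AddCommMonoid M]

theorem sum_subgraph_map {G H : FinGraph.{u}} {h : G.graph →g H.graph}
    (hh : Function.Injective h) (φ : H.graph.Subgraph → M) :
    ∑ L : G.graph.Subgraph, φ (L.map h) =
      ∑ L : H.graph.Subgraph with L ≤ Subgraph.map h ⊤, φ L :=
  Subgraph.sum_map_of_injective hh φ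

theorem sum_subgraph_iso {G H : FinGraph.{u}} (e : G.graph ≃g H.graph)
    (φ : H.graph.Subgraph → M) :
    ∑ L : G.graph.Subgraph, φ (L.map e.toHom) = ∑ L : H.graph.Subgraph, φ L := by
  rw [sum_subgraph_map (h := e.toHom) e.injective, Subgraph.map_iso_top]
  simp

/-- Sum of a function over all pairs of subgraphs that cover the whole graph. -/
def coverSum (θ : (G : FinGraph.{u}) → G.graph.Subgraph → G.graph.Subgraph → M)
    (G : FinGraph.{u}) : M :=
  ∑ q : G.graph.Subgraph × G.graph.Subgraph with q.1 ⊔ q.2 = ⊤, θ G q.1 q.2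

/-- A function of pairs of subgraphs that does not depend on the ambient graph. -/
def PairNatural (θ : (G : FinGraph.{u}) → G.graph.Subgraph → G.graph.Subgraph → M) : Prop :=
  ∀ ⦃G H : FinGraph.{u}⦄ (h : G.graph →g H.graph), Function.Injective h →
    ∀ K L : G.graph.Subgraph, θ H (K.map h) (L.map h) = θ G K L

variable {θ : (G : FinGraph.{u}) → G.graph.Subgraph → G.graph.Subgraph → M}

/-- Both members of a pair with join `h(G)` lie inside `h(G)`, where `map` and `comap` are mutually
inverse. -/
theorem coverSum_eq_of_injective (hθ : PairNatural θ) {G H : FinGraph.{u}}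
    {h : G.graph →g H.graph} (hh : Function.Injective h) :
    coverSum θ G = ∑ q : H.graph.Subgraph × H.graph.Subgraph with
      q.1 ⊔ q.2 = Subgraph.map h ⊤, θ H q.1 q.2 := by
  refine Finset.sum_bij' (fun q _ => (q.1.map h, q.2.map h))
    (fun q _ => (q.1.comap h, q.2.comap h)) ?_ ?_ ?_ ?_ ?_
  · rintro ⟨K, L⟩ hq
    simp only [Finset.mem_filter, Finset.mem_univ, true_and] at hq ⊢
    rw [← Subgraph.map_sup, hq]
  · rintro ⟨K, L⟩ hq
    simp only [Finset.mem_filter, Finset.mem_univ, true_and] at hq ⊢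
    apply Subgraph.map_injective_of_injective hh
    rw [Subgraph.map_sup, Subgraph.map_comap_of_le_map_top (hq ▸ le_sup_left),
      Subgraph.map_comap_of_le_map_top (hq ▸ le_sup_right), hq]
  · rintro ⟨K, L⟩ _
    simp [Subgraph.comap_map_of_injective hh]
  · rintro ⟨K, L⟩ hq
    simp only [Finset.mem_filter, Finset.mem_univ, true_and] at hq
    simp only [Subgraph.map_comap_of_le_map_top (h := h) (hq ▸ le_sup_left : K ≤ _),
      Subgraph.map_comap_of_le_map_top (h := h) (hq ▸ le_sup_right : L ≤ _)]
  · rintro ⟨K, L⟩ _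
    exact (hθ h hh K L).symm

theorem invariant_coverSum (hθ : PairNatural θ) : Invariant (coverSum θ) := by
  rintro G H ⟨e⟩
  rw [coverSum_eq_of_injective hθ (h := e.toHom) e.injective, Subgraph.map_iso_top, coverSum]

theorem coverSum_ofSubgraph (hθ : PairNatural θ) {G : FinGraph.{u}} (K : G.graph.Subgraph) :
    coverSum θ (ofSubgraph K) =
      ∑ q : G.graph.Subgraph × G.graph.Subgraph with q.1 ⊔ q.2 = K, θ G q.1 q.2 := by
  rw [coverSum_eq_of_injective hθ (inclusion_injective K), map_inclusion_top]

end Sums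

/-! ### The algebra of subgraph sums and its relation to `countSpan`. -/

/-- The sum of the values of `c` over all subgraphs. -/
def subgraphSum (c : FinGraph.{u} → ℂ) (G : FinGraph.{u}) : ℂ :=
  ∑ K : G.graph.Subgraph, c (ofSubgraph K)

/-- `g` is the sum over all subgraphs of an invariant weight supported on graphs satisfying `P`. -/
def IsSubgraphSum (P : FinGraph.{u} → Prop) (g : FinGraph.{u} → ℂ) : Prop :=
  ∃ c : FinGraph.{u} → ℂ, Invariant c ∧ (∀ H, c H ≠ 0 → P H) ∧ g = subgraphSum c

variable {P Q R : FinGraph.{u} → Prop} {g g' : FinGraph.{u} → ℂ}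

theorem IsSubgraphSum.mono (hg : IsSubgraphSum P g) (h : ∀ H, P H → Q H) :
    IsSubgraphSum Q g := by
  obtain ⟨c, hc, hP, rfl⟩ := hg
  exact ⟨c, hc, fun H hH => h H (hP H hH), rfl⟩

theorem isSubgraphSum_zero : IsSubgraphSum P 0 :=
  ⟨0, fun _ _ _ => rfl, fun _ h => (h rfl).elim, by ext; simp [subgraphSum]⟩

theorem IsSubgraphSum.add (hg : IsSubgraphSum P g) (hg' : IsSubgraphSum P g') :
    IsSubgraphSum P (g + g') := by
  obtain ⟨c, hc, hP, rfl⟩ := hg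
  obtain ⟨c', hc', hP', rfl⟩ := hg'
  refine ⟨c + c', fun G H h => by simp [hc h, hc' h], fun H hH => ?_, ?_⟩
  · by_cases h : c H = 0
    · exact hP' H fun h' => hH (by simp [h, h'])
    · exact hP H h
  · ext G
    simp [subgraphSum, Finset.sum_add_distrib]

theorem IsSubgraphSum.smul (a : ℂ) (hg : IsSubgraphSum P g) : IsSubgraphSum P (a • g) := by
  obtain ⟨c, hc, hP, rfl⟩ := hg
  refine ⟨a • c, fun G H h => by simp [hc h], fun H hH => hP H fun h => hH (by simp [h]), ?_⟩
  ext G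
  simp [subgraphSum, Finset.mul_sum]

theorem IsSubgraphSum.sum {ι : Type*} {s : Finset ι} {g : ι → FinGraph.{u} → ℂ}
    (hg : ∀ i ∈ s, IsSubgraphSum P (g i)) : IsSubgraphSum P (∑ i ∈ s, g i) :=
  Finset.sum_induction _ _ (fun _ _ => IsSubgraphSum.add) isSubgraphSum_zero hg

/-- The product is a double sum over pairs `(K, L)`; grouping the pairs by `K ⊔ L` gives a subgraph
sum whose weight at a graph sums `c(K) c'(L)` over the pairs covering it. -/
theorem IsSubgraphSum.mul (hg : IsSubgraphSum P g) (hg' : IsSubgraphSum Q g')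
    (h : ∀ (G : FinGraph.{u}) (K L : G.graph.Subgraph), K ⊔ L = ⊤ → P (ofSubgraph K) →
      Q (ofSubgraph L) → R G) :
    IsSubgraphSum R (g * g') := by
  obtain ⟨c, hc, hP, rfl⟩ := hg
  obtain ⟨c', hc', hP', rfl⟩ := hg'
  have hθ : PairNatural fun (G : FinGraph.{u}) (K L : G.graph.Subgraph) =>
      c (ofSubgraph K) * c' (ofSubgraph L) := fun G H h hh K L => by
    dsimp only
    rw [hc (isIso_ofSubgraph_map hh K), hc' (isIso_ofSubgraph_map hh L)]
  refine ⟨_, invariant_coverSum hθ, fun G hG => ?_, ?_⟩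
  · obtain ⟨⟨K, L⟩, hq, hne⟩ := Finset.exists_ne_zero_of_sum_ne_zero hG
    exact h G K L (Finset.mem_filter.1 hq).2 (hP _ (left_ne_zero_of_mul hne))
      (hP' _ (right_ne_zero_of_mul hne))
  · ext G
    simp only [subgraphSum, coverSum_ofSubgraph hθ, Pi.mul_apply]
    rw [Finset.sum_mul_sum, ← Finset.sum_product', Finset.univ_product_univ]
    exact (Finset.sum_fiberwise _ _ _).symm

/-- The labelled graphs with at most `N` vertices. -/
abbrev LabelledGraph (N : ℕ) : Type := Σ n : Fin (N + 1), SimpleGraph (Fin n)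

/-- A labelled graph as a finite graph in a given universe. -/
def ofLabelled {N : ℕ} (A : LabelledGraph N) : FinGraph.{u} where
  V := ULift.{u} (Fin A.1)
  graph := A.2.comap ULift.down

theorem exists_labelled_isIso {N : ℕ} {G : FinGraph.{u}} (hG : G.order ≤ N) :
    ∃ A : LabelledGraph N, (ofLabelled A : FinGraph.{u}).IsIso G := by
  let e : Fin G.order ≃ G.V := (Fintype.equivFin G.V).symm
  exact ⟨⟨⟨G.order, by omega⟩, G.graph.comap e⟩, ⟨⟨Equiv.ulift.trans e, Iff.rfl⟩⟩⟩

theorem subgraphCount_eq_card (H G : FinGraph.{u}) :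
    subgraphCount H G = Finset.card {K : G.graph.Subgraph | H.IsIso (ofSubgraph K)} := by
  unfold subgraphCount copyCount
  congr!

/-- Subgraph sums of bounded invariant weights are combinations of subgraph counts. -/
theorem IsSubgraphSum.mem_countSpan (hg : IsSubgraphSum P g) {N : ℕ}
    (hN : ∀ H, P H → H.order ≤ N) : g ∈ countSpan {H | P H} := by
  obtain ⟨c, hc, hP, rfl⟩ := hg
  -- Labelled graphs modulo isomorphism form a finite index set with one representative `r q` for
  -- each isomorphism class of order at most `N`.
  let s : Setoid (LabelledGraph N) :=
    ⟨fun A B => (ofLabelled A : FinGraph.{u}).IsIso (ofLabelled B),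
      fun _ => .refl _, .symm, .trans⟩
  let r : Quotient s → FinGraph.{u} := fun q => ofLabelled q.out
  have key : subgraphSum c = ∑ q : Quotient s, c (r q) • fun G => (subgraphCount (r q) G : ℂ) := by
    ext G
    simp only [subgraphSum, Finset.sum_apply, Pi.smul_apply, smul_eq_mul, subgraphCount_eq_card,
      Finset.card_filter, Nat.cast_sum, Finset.mul_sum]
    rw [Finset.sum_comm]
    refine Finset.sum_congr rfl fun K _ => ?_
    by_cases hK : c (ofSubgraph K) = 0
    · rw [hK, Finset.sum_eq_zero]
      intro q _
      split_ifs with h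
      · simp [hc h, hK]
      · simp
    · obtain ⟨A, hA⟩ := exists_labelled_isIso.{u} (hN _ (hP _ hK))
      have hout : (r ⟦A⟧).IsIso (ofSubgraph K) :=
        IsIso.trans (Quotient.exact (Quotient.out_eq (⟦A⟧ : Quotient s))) hA
      rw [Finset.sum_eq_single ⟦A⟧]
      · simp [hout, hc hout]
      · intro q _ hq
        rw [if_neg, Nat.cast_zero, mul_zero]
        intro h
        apply hq
        rw [← Quotient.out_eq q]
        exact Quotient.sound (h.trans hA.symm)
      · simp
  rw [key]
  refine Submodule.sum_mem _ fun q _ => ?_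
  -- Nonvanishing of the weight at the representative itself yields `P (r q)`, so `P` need not be
  -- isomorphism-invariant.
  by_cases h : c (r q) = 0
  · simp [h]
  · exact Submodule.smul_mem _ _ (Submodule.subset_span ⟨r q, hP _ h, rfl⟩)

end FinGraph

/-! ### Subadditivity of the rank and of the number of components. -/

namespace SimpleGraph

variable {V V₁ V₂ : Type*}

/-- The rank `|V| - k` is subadditive: it is the rank of the Laplacian, whose kernel consists of
the functions that are constant along edges. -/
theorem card_add_card_connectedComponent_le [Fintype V] [Fintype V₁] [Fintype V₂]
    (G : SimpleGraph V) (G₁ : SimpleGraph V₁) (G₂ : SimpleGraph V₂) (i₁ : V₁ → V) (i₂ : V₂ → V)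
    (h : ∀ u v, G.Adj u v → (∃ a b, G₁.Adj a b ∧ i₁ a = u ∧ i₁ b = v) ∨
      ∃ a b, G₂.Adj a b ∧ i₂ a = u ∧ i₂ b = v) :
    Fintype.card V + Nat.card G₁.ConnectedComponent + Nat.card G₂.ConnectedComponent ≤
      Nat.card G.ConnectedComponent + Fintype.card V₁ + Fintype.card V₂ := by
  simp only [Nat.card_eq_fintype_card,
    card_connectedComponent_eq_finrank_ker_toLin'_lapMatrix]
  set L := Matrix.toLin' (G.lapMatrix ℝ) with hL
  set L₁ := Matrix.toLin' (G₁.lapMatrix ℝ) with hL₁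
  set L₂ := Matrix.toLin' (G₂.lapMatrix ℝ) with hL₂
  -- A function on `V` killed by `T` is constant along the edges coming from both graphs, hence
  -- along all edges of `G`. Rank–nullity for `T` then bounds `|V|` by `rank L₁ + rank L₂ + dim ker
  -- L`.
  let T : (V → ℝ) →ₗ[ℝ] (LinearMap.range L₁ × LinearMap.range L₂) :=
    (L₁.rangeRestrict ∘ₗ LinearMap.funLeft ℝ ℝ i₁).prod
      (L₂.rangeRestrict ∘ₗ LinearMap.funLeft ℝ ℝ i₂)
  have hker : LinearMap.ker T ≤ LinearMap.ker L := by
    intro x hx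
    have hx₁ : L₁ (x ∘ i₁) = 0 := congrArg (fun p => (p.1 : V₁ → ℝ)) hx
    have hx₂ : L₂ (x ∘ i₂) = 0 := congrArg (fun p => (p.2 : V₂ → ℝ)) hx
    rw [LinearMap.mem_ker, hL, Matrix.toLin'_apply, lapMatrix_mulVec_eq_zero_iff_forall_adj]
    rw [hL₁, Matrix.toLin'_apply, lapMatrix_mulVec_eq_zero_iff_forall_adj] at hx₁
    rw [hL₂, Matrix.toLin'_apply, lapMatrix_mulVec_eq_zero_iff_forall_adj] at hx₂
    intro u v huv
    rcases h u v huv with ⟨a, b, hab, rfl, rfl⟩ | ⟨a, b, hab, rfl, rfl⟩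
    · exact hx₁ a b hab
    · exact hx₂ a b hab
  have h1 := Submodule.finrank_mono hker
  have h2 := LinearMap.finrank_range_add_finrank_ker T
  have h3 := LinearMap.finrank_range_add_finrank_ker L₁
  have h4 := LinearMap.finrank_range_add_finrank_ker L₂
  have h5 := Submodule.finrank_le (LinearMap.range T)
  simp only [Module.finrank_prod, Module.finrank_fintype_fun_eq_card] at h2 h3 h4 h5
  omega

end SimpleGraph

namespace FinGraph

/-- `|V| - k` is subadditive with respect to unions of subgraphs. -/
theorem order_add_numComponents_le {G : FinGraph.{u}} {K L : G.graph.Subgraph} (h : K ⊔ L = ⊤) :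
    G.order + (ofSubgraph K).numComponents + (ofSubgraph L).numComponents ≤
      G.numComponents + (ofSubgraph K).order + (ofSubgraph L).order := by
  refine card_add_card_connectedComponent_le G.graph (ofSubgraph K).graph (ofSubgraph L).graph
    (inclusion K) (inclusion L) fun u v huv => ?_
  have huv' : (K ⊔ L).Adj u v := by rw [h]; exact huv
  rcases huv' with huv' | huv'
  · exact .inl ⟨⟨u, K.edge_vert huv'⟩, ⟨v, K.edge_vert huv'.symm⟩, huv', rfl, rfl⟩
  · exact .inr ⟨⟨u, L.edge_vert huv'⟩, ⟨v, L.edge_vert huv'.symm⟩, huv', rfl, rfl⟩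

theorem order_le_add {G : FinGraph.{u}} {K L : G.graph.Subgraph} (h : K ⊔ L = ⊤) :
    G.order ≤ (ofSubgraph K).order + (ofSubgraph L).order := by
  have hv : K.verts ∪ L.verts = Set.univ := by rw [← Subgraph.verts_sup, h, Subgraph.verts_top]
  rw [order_eq_natCard, order_ofSubgraph, order_ofSubgraph, ← Set.ncard_univ, ← hv]
  exact Set.ncard_union_le _ _

theorem order_eq_add {G : FinGraph.{u}} {K L : G.graph.Subgraph} (h : K ⊔ L = ⊤)
    (hd : Disjoint K.verts L.verts) :
    G.order = (ofSubgraph K).order + (ofSubgraph L).order := by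
  have hv : K.verts ∪ L.verts = Set.univ := by rw [← Subgraph.verts_sup, h, Subgraph.verts_top]
  rw [order_eq_natCard, order_ofSubgraph, order_ofSubgraph, ← Set.ncard_univ, ← hv]
  exact Set.ncard_union_eq hd

theorem numComponents_le_add {G : FinGraph.{u}} {K L : G.graph.Subgraph} (h : K ⊔ L = ⊤) :
    G.numComponents ≤ (ofSubgraph K).numComponents + (ofSubgraph L).numComponents := by
  have hv : K.verts ∪ L.verts = Set.univ := by rw [← Subgraph.verts_sup, h, Subgraph.verts_top]
  unfold numComponents
  rw [← Nat.card_sum]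
  refine Nat.card_le_card_of_surjective (Sum.elim
    (ConnectedComponent.map (inclusion K)) (ConnectedComponent.map (inclusion L))) fun C => ?_
  induction C using ConnectedComponent.ind with
  | h v =>
    rcases (hv ▸ Set.mem_univ v : v ∈ K.verts ∪ L.verts) with hvK | hvL
    · exact ⟨.inl ((ofSubgraph K).graph.connectedComponentMk ⟨v, hvK⟩), rfl⟩
    · exact ⟨.inr ((ofSubgraph L).graph.connectedComponentMk ⟨v, hvL⟩), rfl⟩

theorem numComponents_pos {G : FinGraph.{u}} (hG : G.order ≠ 0) : 0 < G.numComponents := by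
  have : Nonempty G.V := Fintype.card_pos_iff.1 (Nat.pos_of_ne_zero hG)
  have v := Classical.arbitrary G.V
  have : Nonempty G.graph.ConnectedComponent := ⟨G.graph.connectedComponentMk v⟩
  exact Nat.card_pos

theorem numComponents_eq_one {G : FinGraph.{u}} (hG : G.graph.Connected) :
    G.numComponents = 1 := by
  have := hG.nonempty
  have := hG.preconnected.subsingleton_connectedComponent
  have v := Classical.arbitrary G.V
  have : Nonempty G.graph.ConnectedComponent := ⟨G.graph.connectedComponentMk v⟩
  exact Nat.card_unique

theorem numComponents_eq_zero {G : FinGraph.{u}} (hG : G.order = 0) : G.numComponents = 0 := by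
  have : IsEmpty G.V := Fintype.card_eq_zero_iff.1 hG
  have : IsEmpty G.graph.ConnectedComponent :=
    ⟨fun C => by induction C using ConnectedComponent.ind with | h v => exact isEmptyElim v⟩
  exact Nat.card_of_isEmpty

/-! ### Splitting disconnected graphs; additive functions; uniqueness of weights. -/

/-- The vertex set `S` is a union of connected components. -/
def Separated (G : FinGraph.{u}) (S : Set G.V) : Prop :=
  ∀ u v, G.graph.Adj u v → (u ∈ S ↔ v ∈ S)

theorem exists_separated {G : FinGraph.{u}} (hG : G.order ≠ 0) (hG' : ¬ G.graph.Connected) :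
    ∃ S : Set G.V, G.Separated S ∧ S.Nonempty ∧ Sᶜ.Nonempty := by
  have : Nonempty G.V := Fintype.card_pos_iff.1 (Nat.pos_of_ne_zero hG)
  have hp : ¬ G.graph.Preconnected := fun h => hG' ⟨h⟩
  simp only [Preconnected, not_forall] at hp
  obtain ⟨u, v, huv⟩ := hp
  exact ⟨{w | G.graph.Reachable u w},
    fun a b hab => ⟨fun h => h.trans hab.reachable, fun h => h.trans hab.symm.reachable⟩,
    ⟨u, .refl u⟩, ⟨v, huv⟩⟩

theorem Separated.isIso_disjUnion {G : FinGraph.{u}} {S : Set G.V} (hS : G.Separated S) :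
    ((G.induce S).disjUnion (G.induce Sᶜ)).IsIso G := by
  refine ⟨⟨Equiv.Set.sumCompl S, ?_⟩⟩
  rintro (⟨a, ha⟩ | ⟨a, ha⟩) (⟨b, hb⟩ | ⟨b, hb⟩)
  · exact Iff.rfl
  · refine iff_of_false (fun h => hb ((hS a b h).1 ha)) Bool.false_ne_true
  · refine iff_of_false (fun h => ha ((hS a b h).2 hb)) Bool.false_ne_true
  · exact Iff.rfl

theorem Separated.subset_or_subset_compl {G : FinGraph.{u}} {S : Set G.V} (hS : G.Separated S)
    {K : G.graph.Subgraph} (hK : (ofSubgraph K).graph.Connected) :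
    K.verts ⊆ S ∨ K.verts ⊆ Sᶜ := by
  have key : ∀ a b : K.verts, (ofSubgraph K).graph.Reachable a b → (a.1 ∈ S ↔ b.1 ∈ S) := by
    rintro a b ⟨p⟩
    induction p with
    | nil => exact Iff.rfl
    | cons h _ ih => exact (hS _ _ (K.adj_sub h)).trans ih
  obtain ⟨v⟩ := hK.nonempty
  by_cases hv : v.1 ∈ S
  · exact .inl fun w hw => (key v ⟨w, hw⟩ (hK.preconnected _ _)).1 hv
  · exact .inr fun w hw hw' => hv ((key v ⟨w, hw⟩ (hK.preconnected _ _)).2 hw')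

/-- The inclusion of an induced subgraph. -/
def inducedInclusion (G : FinGraph.{u}) (S : Set G.V) : (G.induce S).graph →g G.graph :=
  (Embedding.induce S).toHom

theorem inducedInclusion_injective (G : FinGraph.{u}) (S : Set G.V) :
    Function.Injective (G.inducedInclusion S) := Subtype.val_injective

theorem le_map_inducedInclusion_top {G : FinGraph.{u}} {S : Set G.V} {K : G.graph.Subgraph} :
    K ≤ Subgraph.map (G.inducedInclusion S) ⊤ ↔ K.verts ⊆ S := by
  constructor
  · intro h v hv
    obtain ⟨w, -, rfl⟩ := h.1 hv
    exact w.2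
  · intro h
    refine ⟨fun v hv => ⟨⟨v, h hv⟩, trivial, rfl⟩, fun u v huv => ?_⟩
    exact ⟨⟨u, h (K.edge_vert huv)⟩, ⟨v, h (K.edge_vert huv.symm)⟩, K.adj_sub huv, rfl, rfl⟩

theorem sum_subgraph_induce {M : Type*} [AddCommMonoid M] {G : FinGraph.{u}} (S : Set G.V)
    {c : FinGraph.{u} → M} (hc : Invariant c) :
    ∑ L : (G.induce S).graph.Subgraph, c (ofSubgraph L) =
      ∑ L : G.graph.Subgraph with L.verts ⊆ S, c (ofSubgraph L) := by
  have h := sum_subgraph_map (inducedInclusion_injective G S) fun L => c (ofSubgraph L)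
  simp only [le_map_inducedInclusion_top] at h
  rw [← h]
  exact Finset.sum_congr rfl fun L _ =>
    hc (isIso_ofSubgraph_map (inducedInclusion_injective G S) L)

theorem order_induce (G : FinGraph.{u}) (S : Set G.V) : (G.induce S).order = S.ncard :=
  order_eq_natCard _

/-- An additive subgraph sum that ignores the empty graph only counts connected subgraphs. -/
theorem IsSubgraphSum.connected_of_additive {P : FinGraph.{u} → Prop} {g : FinGraph.{u} → ℂ}
    (hg : IsSubgraphSum P g) (hP : ∀ H, P H → H.order ≠ 0) (hinv : Invariant g)
    (hadd : ∀ G₁ G₂, g (G₁.disjUnion G₂) = g G₁ + g G₂) :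
    IsSubgraphSum (fun H => P H ∧ H.graph.Connected) g := by
  obtain ⟨c, hc, hcP, rfl⟩ := hg
  suffices h : ∀ G : FinGraph.{u}, ¬ G.graph.Connected → c G = 0 from
    ⟨c, hc, fun H hH => ⟨hcP H hH, not_not.1 fun h' => hH (h H h')⟩, rfl⟩
  intro G
  induction G using subgraph_induction with
  | ih G ih =>
    intro hG
    by_contra hne
    obtain ⟨S, hS, hS₁, hS₂⟩ := exists_separated (hP G (hcP G hne)) hG
    have h1 := hadd (G.induce S) (G.induce Sᶜ)
    rw [hinv hS.isIso_disjUnion] at h1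
    simp only [subgraphSum, sum_subgraph_induce _ hc, Finset.sum_filter,
      ← Finset.sum_add_distrib] at h1
    -- Compare the sum over all subgraphs with the sums over those inside `S` or inside `Sᶜ`. By
    -- induction a proper subgraph of nonzero weight is connected, so it lies in exactly one side
    -- and cancels; `⊤` lies in neither and leaves `c G = 0`.
    rw [← sub_eq_zero, ← Finset.sum_sub_distrib, Finset.sum_eq_single ⊤] at h1
    · rw [if_neg, if_neg, add_zero, sub_zero, hc (isIso_ofSubgraph_top G)] at h1
      · exact hne h1
      · obtain ⟨v, hv⟩ := hS₁
        exact fun h => h (Set.mem_univ v) hv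
      · obtain ⟨v, hv⟩ := hS₂
        exact fun h => hv (h (Set.mem_univ v))
    · intro K _ hK
      by_cases hcK : c (ofSubgraph K) = 0
      · simp [hcK]
      have hconn : (ofSubgraph K).graph.Connected := not_not.1 fun h => hcK (ih K hK h)
      obtain ⟨v⟩ := hconn.nonempty
      rcases hS.subset_or_subset_compl hconn with h | h
      · rw [if_pos h, if_neg fun h' => h' v.2 (h v.2)]
        simp
      · rw [if_pos h, if_neg fun h' => h v.2 (h' v.2)]
        simp
    · simp

theorem subgraph_eq_bot {G : FinGraph.{u}} {K : G.graph.Subgraph} (h : K.verts = ∅) : K = ⊥ := by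
  refine le_bot_iff.1 ⟨h.le, fun u v huv => ?_⟩
  have := K.edge_vert huv
  simp [h] at this

theorem order_ofSubgraph_eq_zero {G : FinGraph.{u}} {K : G.graph.Subgraph} :
    (ofSubgraph K).order = 0 ↔ K = ⊥ := by
  rw [order_ofSubgraph, Set.ncard_eq_zero]
  exact ⟨subgraph_eq_bot, fun h => by rw [h, Subgraph.verts_bot]⟩

theorem order_ofSubgraph_bot (G : FinGraph.{u}) :
    (ofSubgraph (⊥ : G.graph.Subgraph)).order = 0 := order_ofSubgraph_eq_zero.2 rfl

theorem order_ofSubgraph_top (G : FinGraph.{u}) :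
    (ofSubgraph (⊤ : G.graph.Subgraph)).order = G.order :=
  invariant_order (isIso_ofSubgraph_top G)

theorem verts_eq_univ {G : FinGraph.{u}} {K : G.graph.Subgraph}
    (h : (ofSubgraph K).order = G.order) : K.verts = Set.univ := by
  rw [order_ofSubgraph, order_eq_natCard, ← Set.ncard_univ] at h
  exact Set.eq_of_subset_of_ncard_le (Set.subset_univ _) h.ge

theorem bot_ne_top {G : FinGraph.{u}} (hG : G.order ≠ 0) : (⊥ : G.graph.Subgraph) ≠ ⊤ := by
  intro h
  rw [← order_ofSubgraph_top, ← h, order_ofSubgraph_bot] at hG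
  exact hG rfl

/-- A weighted sum over all subgraphs determines its summands. -/
theorem eq_of_weighted_sum_eq (w : ℂ) {a b : FinGraph.{u} → ℂ} (ha : Invariant a)
    (hb : Invariant b)
    (h : ∀ G : FinGraph.{u},
      ∑ K : G.graph.Subgraph, w ^ (G.order - (ofSubgraph K).order) * a (ofSubgraph K) =
      ∑ K : G.graph.Subgraph, w ^ (G.order - (ofSubgraph K).order) * b (ofSubgraph K))
    (G : FinGraph.{u}) : a G = b G := by
  induction G using subgraph_induction with
  | ih G ih =>
    have h1 := h G
    -- The surviving summand has weight `w ^ 0 = 1`, so `w = 0` is allowed.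
    rw [← sub_eq_zero, ← Finset.sum_sub_distrib, Fintype.sum_eq_single ⊤] at h1
    · simpa [order_ofSubgraph_top, ha (isIso_ofSubgraph_top G), hb (isIso_ofSubgraph_top G),
        sub_eq_zero] using h1
    · intro K hK
      rw [ih K hK, sub_self]

end FinGraph

/-- The binomial theorem over the sets that contain `K` and avoid `L`. -/
theorem sum_sets_separating {V : Type*} [Fintype V] (K L : Set V) (x y : ℂ) :
    ∑ S : Set V, (if K ⊆ S ∧ L ⊆ Sᶜ then
        x ^ (S.ncard - K.ncard) * y ^ (Sᶜ.ncard - L.ncard) else 0) =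
      if Disjoint K L then (x + y) ^ (Nat.card V - (K ∪ L).ncard) else 0 := by
  split_ifs with hKL
  · have hcard : ((K ∪ L)ᶜ.toFinset).card = Nat.card V - (K ∪ L).ncard := by
      rw [← Set.ncard_eq_toFinset_card', Set.ncard_compl]
    rw [← Finset.sum_filter, ← hcard, ← Finset.sum_pow_mul_eq_add_pow]
    -- Such an `S` amounts to a free choice of `T = S \ K` among the vertices outside `K ∪ L`.
    refine Finset.sum_bij' (fun S _ => (S \ K).toFinset) (fun T _ => K ∪ T) ?_ ?_ ?_ ?_ ?_
    · intro S hS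
      simp only [Finset.mem_filter, Finset.mem_univ, true_and] at hS
      simp only [Finset.mem_powerset, Set.toFinset_subset_toFinset]
      rintro v ⟨hv, hv'⟩ (h | h)
      · exact hv' h
      · exact hS.2 h hv
    · intro T hT
      simp only [Finset.mem_powerset, Set.subset_toFinset] at hT
      simp only [Finset.mem_filter, Finset.mem_univ, true_and]
      refine ⟨Set.subset_union_left, ?_⟩
      rintro v hv (h | h)
      · exact hKL.le_bot ⟨h, hv⟩
      · exact hT h (.inr hv)
    · intro S hS
      simp only [Finset.mem_filter, Finset.mem_univ, true_and] at hS
      simp [hS.1]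
    · intro T hT
      simp only [Finset.mem_powerset, Set.subset_toFinset] at hT
      ext v
      have : v ∈ T → v ∉ K := fun h h' => hT h (.inl h')
      simp only [Set.mem_toFinset, Set.mem_sdiff, Set.mem_union, Finset.mem_coe]
      tauto
    · intro S hS
      simp only [Finset.mem_filter, Finset.mem_univ, true_and] at hS
      have h1 : (S \ K).toFinset.card = S.ncard - K.ncard := by
        rw [← Set.ncard_eq_toFinset_card', Set.ncard_sdiff hS.1]
      have h2 : K.ncard ≤ S.ncard := Set.ncard_le_ncard hS.1
      have h3 : L.ncard ≤ Sᶜ.ncard := Set.ncard_le_ncard hS.2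
      have h4 := Set.ncard_add_ncard_compl S
      have h5 := Set.ncard_union_eq hKL
      rw [h1, hcard]
      congr 2
      omega
  · refine Finset.sum_eq_zero fun S _ => if_neg ?_
    rintro ⟨h1, h2⟩
    exact hKL (Set.disjoint_left.2 fun v hv hv' => h2 hv' (h1 hv))

/-! ### The core of a graph polynomial and its convolution identity. -/

namespace GraphPolynomial

open FinGraph

/-- The polynomials `D` with `f(G) = ∑_K X^{|V(G)| - |V(K)|} D(K)`, summed over the subgraphs `K`
of `G`. -/
def core (f : GraphPolynomial.{u}) (G : FinGraph.{u}) : ℂ[X] :=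
  f G - ∑ K : {K : G.graph.Subgraph // K ≠ ⊤},
    X ^ (G.order - (ofSubgraph K.1).order) * core f (ofSubgraph K.1)
termination_by Fintype.card G.graph.Subgraph
decreasing_by exact card_subgraph_lt K.2

variable {f : GraphPolynomial.{u}}

theorem core_eq (f : GraphPolynomial.{u}) (G : FinGraph.{u}) :
    core f G = f G - ∑ K : G.graph.Subgraph, if K ≠ ⊤ then
      X ^ (G.order - (ofSubgraph K).order) * core f (ofSubgraph K) else 0 := by
  rw [core, ← Finset.sum_filter, Finset.sum_subtype (p := fun K : G.graph.Subgraph => K ≠ ⊤) _ (by simp)]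

theorem invariant_core (hiso : f.IsoInvariant) : Invariant (core f) := by
  intro G
  induction G using subgraph_induction with
  | ih G ih =>
    rintro H ⟨e⟩
    rw [core_eq, core_eq, hiso G H ⟨e⟩, ← sum_subgraph_iso e]
    congr 1
    refine Finset.sum_congr rfl fun K _ => ?_
    have htop : K.map e.toHom = ⊤ ↔ K = ⊤ := by
      rw [← Subgraph.map_iso_top e]
      exact (Subgraph.map_injective_of_injective e.injective).eq_iff
    have hKm := isIso_ofSubgraph_map (h := e.toHom) e.injective K
    simp only [ne_eq, htop]
    split_ifs with hK
    · rfl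
    · rw [ih K hK hKm, invariant_order hKm, invariant_order ⟨e⟩]

theorem eq_sum_core (hiso : f.IsoInvariant) (G : FinGraph.{u}) :
    f G = ∑ K : G.graph.Subgraph,
      X ^ (G.order - (ofSubgraph K).order) * core f (ofSubgraph K) := by
  have h := core_eq f G
  rw [eq_sub_iff_add_eq] at h
  rw [← h, ← Finset.sum_filter, ← invariant_core hiso (isIso_ofSubgraph_top G),
    ← Finset.add_sum_erase _ _ (Finset.mem_univ ⊤), order_ofSubgraph_top]
  simp only [Nat.sub_self, pow_zero, one_mul]
  congr 2
  ext K
  simp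

/-- The summand of the convolution identity of `core`. -/
def corePair (f : GraphPolynomial.{u}) (x y : ℂ) (G : FinGraph.{u}) (K L : G.graph.Subgraph) : ℂ :=
  if Disjoint K.verts L.verts then
    (core f (ofSubgraph K)).eval x * (core f (ofSubgraph L)).eval y else 0

theorem pairNatural_corePair (hiso : f.IsoInvariant) (x y : ℂ) : PairNatural (corePair f x y) := by
  intro G H h hh K L
  simp only [corePair, Subgraph.map_verts, Set.disjoint_image_iff hh,
    ← invariant_core hiso (isIso_ofSubgraph_map hh K),
    ← invariant_core hiso (isIso_ofSubgraph_map hh L)]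

theorem eval_induce (hiso : f.IsoInvariant) (G : FinGraph.{u}) (S : Set G.V) (x : ℂ) :
    (f (G.induce S)).eval x = ∑ K : G.graph.Subgraph, if K.verts ⊆ S then
      x ^ (S.ncard - K.verts.ncard) * (core f (ofSubgraph K)).eval x else 0 := by
  rw [eq_sum_core hiso, eval_finsetSum, ← Finset.sum_filter]
  simp only [eval_mul, eval_pow, eval_X, order_induce]
  rw [sum_subgraph_induce (c := fun H => x ^ (S.ncard - H.order) * (core f H).eval x) S]
  · simp only [order_ofSubgraph]
  · intro H H' h
    simp only [invariant_order h, invariant_core hiso h]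

/-- Both sides have the same weighted subgraph sums, namely `f(G, x+y)`, and these determine the
weights. For the right side, expand the exponential identity over `S`, `K ⊆ G[S]` and `L ⊆ G[Sᶜ]`.
-/
theorem eval_core_add (hiso : f.IsoInvariant) (hexp : f.ExponentialType) (x y : ℂ)
    (G : FinGraph.{u}) : (core f G).eval (x + y) = coverSum (corePair f x y) G := by
  refine eq_of_weighted_sum_eq (x + y) (a := fun G => (core f G).eval (x + y))
    (fun H H' h => by simp only [invariant_core hiso h])
    (invariant_coverSum (pairNatural_corePair hiso x y)) (fun G => ?_) G
  have h1 : ∑ K : G.graph.Subgraph,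
      (x + y) ^ (G.order - (ofSubgraph K).order) * (core f (ofSubgraph K)).eval (x + y) =
      (f G).eval (x + y) := by
    rw [eq_sum_core hiso G, eval_finsetSum]
    simp
  have h3 : ∀ S : Set G.V, ∀ K L : G.graph.Subgraph,
      (if K.verts ⊆ S then x ^ (S.ncard - K.verts.ncard) * (core f (ofSubgraph K)).eval x else 0) *
      (if L.verts ⊆ Sᶜ then
        y ^ (Sᶜ.ncard - L.verts.ncard) * (core f (ofSubgraph L)).eval y else 0) =
      (if K.verts ⊆ S ∧ L.verts ⊆ Sᶜ then
        x ^ (S.ncard - K.verts.ncard) * y ^ (Sᶜ.ncard - L.verts.ncard) else 0) *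
      ((core f (ofSubgraph K)).eval x * (core f (ofSubgraph L)).eval y) := by
    intro S K L
    by_cases h1 : K.verts ⊆ S <;> by_cases h2 : L.verts ⊆ Sᶜ <;> simp [h1, h2]
    ring
  have h4 : ∑ K : G.graph.Subgraph, (x + y) ^ (G.order - (ofSubgraph K).order) *
      coverSum (corePair f x y) (ofSubgraph K) =
      ∑ q : G.graph.Subgraph × G.graph.Subgraph,
        (x + y) ^ (G.order - (ofSubgraph (q.1 ⊔ q.2)).order) * corePair f x y G q.1 q.2 := by
    rw [← Finset.sum_fiberwise _ (fun q : G.graph.Subgraph × G.graph.Subgraph => q.1 ⊔ q.2)]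
    refine Finset.sum_congr rfl fun K _ => ?_
    rw [coverSum_ofSubgraph (pairNatural_corePair hiso x y), Finset.mul_sum]
    refine Finset.sum_congr rfl fun q hq => ?_
    rw [(Finset.mem_filter.1 hq).2]
  rw [h1, h4, ← hexp.2 G x y]
  simp only [eval_induce hiso, Finset.sum_mul_sum, h3]
  -- Interchange sums so that, for a fixed pair `(K, L)`, the sum over `S` is innermost; the
  -- binomial theorem evaluates it to `(x+y)^(|G|-|K ∪ L|)` when `K` and `L` are disjoint, and to
  -- zero otherwise.
  simp_rw [← Fintype.sum_prod_type']
  rw [Fintype.sum_prod_type_right]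
  refine Finset.sum_congr rfl fun q _ => ?_
  dsimp only
  rw [← Finset.sum_mul, sum_sets_separating, corePair, order_ofSubgraph, order_eq_natCard,
    Subgraph.verts_sup]
  split_ifs <;> simp

end GraphPolynomial

/-! ### Newton's identities for multisets, and further facts on covers. -/

theorem Multiset.psum_eq_mul_esymm_sub_sum (s : Multiset ℂ) {k : ℕ} (hk : 0 < k) :
    (s.map fun z => z ^ k).sum = (-1) ^ (k + 1) * k * s.esymm k -
      ∑ a ∈ Finset.HasAntidiagonal.antidiagonal k with a.1 ∈ Set.Ioo 0 k,
        (-1) ^ a.1 * s.esymm a.1 * (s.map fun z => z ^ a.2).sum := by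
  obtain ⟨n, v, rfl⟩ : ∃ (n : ℕ) (v : Fin n → ℂ), s = Finset.univ.val.map v := by
    induction s using Quotient.inductionOn with
    | h l => exact ⟨l.length, l.get, by simp⟩
  have h := congrArg (MvPolynomial.aeval v) (MvPolynomial.psum_eq_mul_esymm_sub_sum (Fin n) ℂ k hk)
  simp only [map_sub, map_mul, map_sum, map_pow, map_neg, map_one, map_natCast,
    MvPolynomial.aeval_esymm_eq_multiset_esymm] at h
  have hp : ∀ m, MvPolynomial.aeval v (MvPolynomial.psum (Fin n) ℂ m) =
      ((Finset.univ.val.map v).map fun z => z ^ m).sum := by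
    intro m
    rw [Multiset.map_map, MvPolynomial.psum, map_sum]
    simp only [map_pow, MvPolynomial.aeval_X]
    rfl
  simpa only [hp] using h

namespace FinGraph

/-- One inequality is `numComponents_le_add`; the other is subadditivity of the rank, since orders
add exactly for disjoint pieces. -/
theorem numComponents_eq_add {G : FinGraph.{u}} {K L : G.graph.Subgraph} (h : K ⊔ L = ⊤)
    (hd : Disjoint K.verts L.verts) :
    G.numComponents = (ofSubgraph K).numComponents + (ofSubgraph L).numComponents := by
  have h1 := numComponents_le_add h
  have h2 := order_add_numComponents_le h
  have h3 := order_eq_add h hd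
  omega

theorem isolateFree_of_connected {G : FinGraph.{u}} (hG : G.graph.Connected)
    (h2 : 2 ≤ G.order) : G.IsolateFree := by
  intro v hv
  have : Nontrivial G.V := Fintype.one_lt_card_iff_nontrivial.1 h2
  obtain ⟨w, hw⟩ := exists_ne v
  obtain ⟨p⟩ := hG.preconnected v w
  cases p with
  | nil => exact hw rfl
  | cons h _ => exact hv _ h

theorem isolateFree_of_cover {G : FinGraph.{u}} {K L : G.graph.Subgraph}
    (h : K ⊔ L = ⊤) (hK : (ofSubgraph K).IsolateFree) (hL : (ofSubgraph L).IsolateFree) :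
    G.IsolateFree := by
  have hv : K.verts ∪ L.verts = Set.univ := by rw [← Subgraph.verts_sup, h, Subgraph.verts_top]
  intro v hiso
  rcases (hv ▸ Set.mem_univ v : v ∈ K.verts ∪ L.verts) with hvK | hvL
  · exact hK ⟨v, hvK⟩ fun w hw => hiso w.1 (K.adj_sub hw)
  · exact hL ⟨v, hvL⟩ fun w hw => hiso w.1 (L.adj_sub hw)

end FinGraph

/-! ### Where the coefficients of the core are nonzero. -/

namespace GraphPolynomial

open FinGraph

variable {f : GraphPolynomial.{u}}

theorem core_eq_one (hexp : f.ExponentialType) {G : FinGraph.{u}} (hG : G.order = 0) :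
    core f G = 1 := by
  have : IsEmpty G.V := Fintype.card_eq_zero_iff.1 hG
  rw [core_eq, hexp.1 G this, Finset.sum_eq_zero, sub_zero]
  intro K _
  rw [if_neg]
  rw [not_not]
  ext v
  · exact isEmptyElim v
  · exact isEmptyElim v

/-- At `x = y = 0` the splittings `(⊤, ⊥)` and `(⊥, ⊤)` each contribute `c_0(G)` and all others
vanish by induction, so `c_0(G) = 2 c_0(G)`. -/
theorem coeff_zero_core (hiso : f.IsoInvariant) (hexp : f.ExponentialType) {G : FinGraph.{u}}
    (hG : G.order ≠ 0) : (core f G).coeff 0 = 0 := by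
  induction G using subgraph_induction with
  | ih G ih =>
    have h := eval_core_add hiso hexp 0 0 G
    have hbt := bot_ne_top hG
    rw [add_zero, coverSum, Finset.sum_eq_add (⊤, ⊥) (⊥, ⊤)] at h
    · simp only [corePair, Subgraph.verts_bot, Set.disjoint_empty, Set.empty_disjoint, if_true,
        core_eq_one hexp (order_ofSubgraph_bot G), eval_one, mul_one, one_mul,
        invariant_core hiso (isIso_ofSubgraph_top G)] at h
      rw [coeff_zero_eq_eval_zero]
      exact left_eq_add.1 h
    · simp [hbt.symm]
    · rintro ⟨K, L⟩ hq ⟨h1, h2⟩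
      simp only [Finset.mem_filter, Finset.mem_univ, true_and] at hq
      simp only [corePair]
      split_ifs with hd
      swap
      · rfl
      have hK : K ≠ ⊥ := by
        rintro rfl
        rw [bot_sup_eq] at hq
        exact h2 (by rw [hq])
      have hL : L ≠ ⊥ := by
        rintro rfl
        rw [sup_bot_eq] at hq
        exact h1 (by rw [hq])
      have hKt : K ≠ ⊤ := by
        rintro rfl
        exact hL (subgraph_eq_bot (by simpa using hd))
      rw [← coeff_zero_eq_eval_zero, ih K hKt (fun h => hK (order_ofSubgraph_eq_zero.1 h)),
        zero_mul]
    · simp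
    · simp

/-- For a single vertex, `f = X + core` because the only subgraphs are `⊥` and `⊤`; the leading
coefficient 1 is already used up by `⊥`. -/
theorem coeff_one_core_ne_zero (hiso : f.IsoInvariant) (hmonic : f.IsMonic)
    (hexp : f.ExponentialType) {G : FinGraph.{u}} (hG : (core f G).coeff 1 ≠ 0) :
    2 ≤ G.order := by
  by_contra hlt
  have h0 : G.order ≠ 0 := fun h => hG (by rw [core_eq_one hexp h, coeff_one]; simp)
  have h1 : G.order = 1 := by omega
  have hf : (f G).coeff 1 = 1 := by
    have h := (hmonic G).1
    rwa [Monic, leadingCoeff, (hmonic G).2, h1] at h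
  rw [eq_sum_core hiso, finsetSum_coeff, Fintype.sum_eq_add ⊤ ⊥ (bot_ne_top h0).symm,
    order_ofSubgraph_top, order_ofSubgraph_bot, core_eq_one hexp (order_ofSubgraph_bot G), h1,
    invariant_core hiso (isIso_ofSubgraph_top G)] at hf
  · exact hG (by simpa using hf)
  · rintro K ⟨hK, hK'⟩
    have hle := order_ofSubgraph_le K
    have hne : (ofSubgraph K).order ≠ 0 := fun h => hK' (order_ofSubgraph_eq_zero.1 h)
    have hv := verts_eq_univ (K := K) (by omega)
    have hsub : Subsingleton G.V := Fintype.card_le_one_iff_subsingleton.1 h1.le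
    exfalso
    apply hK
    ext u v
    · simp [hv]
    · obtain rfl := Subsingleton.elim u v
      exact iff_of_false (fun h => h.ne rfl) (fun h => h.ne rfl)

/-- The coefficient recursion obtained by differentiating the convolution identity. -/
theorem succ_mul_coeff_core (hiso : f.IsoInvariant) (hexp : f.ExponentialType) (G : FinGraph.{u})
    (j : ℕ) : (core f G).coeff (j + 1) * (j + 1) =
      ∑ q : G.graph.Subgraph × G.graph.Subgraph with q.1 ⊔ q.2 = ⊤,
        if Disjoint q.1.verts q.2.verts then
          (core f (ofSubgraph q.1)).coeff 1 * (core f (ofSubgraph q.2)).coeff j else 0 := by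
  -- With `y` fixed, the convolution is an identity of polynomials in `x`; its linear coefficient is
  -- the derivative at `y`.
  have h1 : ∀ y : ℂ, taylor y (core f G) =
      ∑ q : G.graph.Subgraph × G.graph.Subgraph with q.1 ⊔ q.2 = ⊤,
        if Disjoint q.1.verts q.2.verts then
          core f (ofSubgraph q.1) * C ((core f (ofSubgraph q.2)).eval y) else 0 := by
    intro y
    refine Polynomial.funext fun x => ?_
    rw [taylor_eval, eval_core_add hiso hexp, coverSum, eval_finsetSum]
    refine Finset.sum_congr rfl fun q _ => ?_
    rw [corePair]
    split_ifs <;> simp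
  have h2 : derivative (core f G) =
      ∑ q : G.graph.Subgraph × G.graph.Subgraph with q.1 ⊔ q.2 = ⊤,
        if Disjoint q.1.verts q.2.verts then
          C ((core f (ofSubgraph q.1)).coeff 1) * core f (ofSubgraph q.2) else 0 := by
    refine Polynomial.funext fun y => ?_
    rw [← taylor_coeff_one, h1, finsetSum_coeff, eval_finsetSum]
    refine Finset.sum_congr rfl fun q _ => ?_
    split_ifs <;> simp
  rw [← coeff_derivative, h2, finsetSum_coeff]
  refine Finset.sum_congr rfl fun q _ => ?_
  split_ifs <;> simp

theorem exists_cover_of_coeff_core_ne_zero (hiso : f.IsoInvariant) (hexp : f.ExponentialType)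
    {G : FinGraph.{u}} {j : ℕ} (h : (core f G).coeff (j + 1) ≠ 0) :
    ∃ K L : G.graph.Subgraph, K ⊔ L = ⊤ ∧ Disjoint K.verts L.verts ∧
      (core f (ofSubgraph K)).coeff 1 ≠ 0 ∧ (core f (ofSubgraph L)).coeff j ≠ 0 := by
  have h1 : (core f G).coeff (j + 1) * (j + 1) ≠ 0 :=
    mul_ne_zero h (by exact_mod_cast Nat.succ_ne_zero j)
  rw [succ_mul_coeff_core hiso hexp] at h1
  obtain ⟨q, hq, hne⟩ := Finset.exists_ne_zero_of_sum_ne_zero h1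
  split_ifs at hne with hd
  · exact ⟨q.1, q.2, (Finset.mem_filter.1 hq).2, hd, left_ne_zero_of_mul hne,
      right_ne_zero_of_mul hne⟩
  · exact (hne rfl).elim

/-- Each step of the recursion splits off a piece with at least two vertices and at least one
component. -/
theorem coeff_core_ne_zero (hiso : f.IsoInvariant) (hmonic : f.IsMonic)
    (hexp : f.ExponentialType) {G : FinGraph.{u}} {j : ℕ} (h : (core f G).coeff j ≠ 0) :
    2 * j ≤ G.order ∧ j ≤ G.numComponents := by
  induction j generalizing G with
  | zero => simp
  | succ j ih =>
    obtain ⟨K, L, hKL, hd, hK, hL⟩ := exists_cover_of_coeff_core_ne_zero hiso hexp h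
    have h1 := coeff_one_core_ne_zero hiso hmonic hexp hK
    have h2 := ih hL
    have h3 := order_eq_add hKL hd
    have h4 := numComponents_eq_add hKL hd
    have h5 := numComponents_pos (G := ofSubgraph K) (by omega)
    omega

theorem coeff_zero_eq_zero (hiso : f.IsoInvariant) (hexp : f.ExponentialType) {G : FinGraph.{u}}
    (hG : G.order ≠ 0) : (f G).coeff 0 = 0 := by
  rw [eq_sum_core hiso, finsetSum_coeff]
  refine Finset.sum_eq_zero fun K _ => ?_
  rw [mul_coeff_zero, coeff_X_pow]
  split_ifs with h
  · have := order_ofSubgraph_le K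
    rw [coeff_zero_core hiso hexp (by omega), mul_zero]
  · rw [zero_mul]

/-- `f(G)` is a product of two polynomials without constant term. -/
theorem coeff_one_eq_zero_of_not_connected (hiso : f.IsoInvariant) (hexp : f.ExponentialType)
    (hmul : f.Multiplicative) {G : FinGraph.{u}} (hG : G.order ≠ 0) (hG' : ¬ G.graph.Connected) :
    (f G).coeff 1 = 0 := by
  obtain ⟨S, hS, hS₁, hS₂⟩ := exists_separated hG hG'
  rw [← hiso _ _ hS.isIso_disjUnion, hmul, mul_coeff_one,
    coeff_zero_eq_zero hiso hexp, coeff_zero_eq_zero hiso hexp]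
  · simp
  · rw [order_induce]
    exact hS₂.ncard_pos.ne'
  · rw [order_induce]
    exact hS₁.ncard_pos.ne'

theorem connected_of_coeff_one_core_ne_zero (hiso : f.IsoInvariant) (hmonic : f.IsMonic)
    (hexp : f.ExponentialType) (hmul : f.Multiplicative) {G : FinGraph.{u}}
    (hG : (core f G).coeff 1 ≠ 0) : G.graph.Connected := by
  induction G using subgraph_induction with
  | ih G ih =>
    by_contra hconn
    have h2 := coeff_one_core_ne_zero hiso hmonic hexp hG
    have h0 := coeff_one_eq_zero_of_not_connected hiso hexp hmul (by omega) hconn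
    rw [eq_sum_core hiso, finsetSum_coeff, Fintype.sum_eq_single ⊤, order_ofSubgraph_top,
      Nat.sub_self, pow_zero, one_mul, invariant_core hiso (isIso_ofSubgraph_top G)] at h0
    · exact hG h0
    · intro K hK
      have hle := order_ofSubgraph_le K
      rw [coeff_X_pow_mul']
      split_ifs with h
      -- A proper subgraph `K` matters only if it omits at most one vertex. If it omits none,
      -- `c_1(K) ≠ 0` would make `K` connected and spanning, hence `G` connected. If it omits one,
      -- `c_0(K)` enters, which is zero as `K` is nonempty.
      · rcases Nat.le_one_iff_eq_zero_or_eq_one.1 h with h' | h'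
        · rw [h', Nat.sub_zero]
          by_contra hne
          have hK' := ih K hK hne
          have hv := verts_eq_univ (K := K) (by omega)
          apply hconn
          have hsurj : Function.Surjective (inclusion K) := fun v =>
            ⟨⟨v, hv ▸ Set.mem_univ v⟩, rfl⟩
          exact hK'.map (inclusion K) hsurj
        · rw [h', Nat.sub_self]
          exact coeff_zero_core hiso hexp (by omega)
      · rfl

theorem coeff_core_ne_zero_of_multiplicative (hiso : f.IsoInvariant) (hmonic : f.IsMonic)
    (hexp : f.ExponentialType) (hmul : f.Multiplicative) {G : FinGraph.{u}} {j : ℕ}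
    (h : (core f G).coeff j ≠ 0) : G.IsolateFree ∧ G.numComponents = j := by
  induction j generalizing G with
  | zero =>
    have h0 : G.order = 0 := not_not.1 fun h0 => h (coeff_zero_core hiso hexp h0)
    have : IsEmpty G.V := Fintype.card_eq_zero_iff.1 h0
    exact ⟨fun v => isEmptyElim v, numComponents_eq_zero h0⟩
  | succ j ih =>
    obtain ⟨K, L, hKL, hd, hK, hL⟩ := exists_cover_of_coeff_core_ne_zero hiso hexp h
    have h1 := coeff_one_core_ne_zero hiso hmonic hexp hK
    have h2 := connected_of_coeff_one_core_ne_zero hiso hmonic hexp hmul hK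
    obtain ⟨h3, h4⟩ := ih hL
    refine ⟨isolateFree_of_cover hKL (isolateFree_of_connected h2 h1) h3, ?_⟩
    rw [numComponents_eq_add hKL hd, numComponents_eq_one h2, h4, add_comm]

/-- The coefficients `e_k` are sums over subgraphs of the coefficients of `core`. -/
theorem isSubgraphSum_e (hiso : f.IsoInvariant) (hexp : f.ExponentialType) {k : ℕ} (hk : 1 ≤ k) :
    IsSubgraphSum (fun H => k + 1 ≤ H.order ∧ (core f H).coeff (H.order - k) ≠ 0) (f.e k) := by
  -- The guard matters: truncated subtraction would otherwise read the constant coefficient, which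
  -- is 1 for the empty graph.
  refine ⟨fun H => if k ≤ H.order then (-1) ^ k * (core f H).coeff (H.order - k) else 0,
    fun G H h => by simp only [invariant_order h, invariant_core hiso h], fun H hH => ?_, ?_⟩
  · dsimp only at hH ⊢
    split_ifs at hH with hle
    · have hne := right_ne_zero_of_mul hH
      refine ⟨?_, hne⟩
      rcases hle.lt_or_eq with h | h
      · exact h
      · rw [← h, Nat.sub_self, coeff_zero_core hiso hexp (by omega)] at hne
        exact (hne rfl).elim
    · exact (hH rfl).elim
  · ext G
    simp only [e, subgraphSum]
    split_ifs with hle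
    · rw [eq_sum_core hiso, finsetSum_coeff, Finset.mul_sum]
      refine Finset.sum_congr rfl fun K _ => ?_
      have := order_ofSubgraph_le K
      rw [coeff_X_pow_mul']
      split_ifs with h1 h2 h2
      · rw [show G.order - k - (G.order - (ofSubgraph K).order) = (ofSubgraph K).order - k by
          omega]
      · omega
      · omega
      · rw [mul_zero]
    · symm
      refine Finset.sum_eq_zero fun K _ => if_neg ?_
      have := order_ofSubgraph_le K
      omega

/-! ### Power sums of the roots. -/

theorem e_eq_esymm (hmonic : f.IsMonic) (k : ℕ) (G : FinGraph.{u}) :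
    f.e k G = (f G).roots.esymm k := by
  have hcard : Multiset.card (f G).roots = (f G).natDegree :=
    splits_iff_card_roots.1 (IsAlgClosed.splits _)
  have hdeg := (hmonic G).2
  simp only [e]
  split_ifs with h
  · rw [coeff_eq_esymm_roots_of_card hcard (by omega), (hmonic G).1, hdeg,
      Nat.sub_sub_self h, one_mul, ← mul_assoc, ← mul_pow]
    simp
  · rw [Multiset.esymm, Multiset.powersetCard_eq_empty _ (by omega)]
    simp

theorem p_eq (hmonic : f.IsMonic) {k : ℕ} (hk : 0 < k) :
    f.p k = ((-1) ^ (k + 1) * k : ℂ) • f.e k +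
      ∑ a ∈ Finset.HasAntidiagonal.antidiagonal k with a.1 ∈ Set.Ioo 0 k,
        (-(-1) ^ a.1 : ℂ) • (f.e a.1 * f.p a.2) := by
  ext G
  simp only [p, Pi.add_apply, Finset.sum_apply, Pi.smul_apply, Pi.mul_apply, smul_eq_mul,
    e_eq_esymm hmonic]
  rw [Multiset.psum_eq_mul_esymm_sub_sum _ hk, sub_eq_add_neg, ← Finset.sum_neg_distrib]
  congr 1
  refine Finset.sum_congr rfl fun a _ => ?_
  ring

/-- The bounds on the subgraphs counted by the power sums. -/
def PowerSumBound (k : ℕ) (H : FinGraph.{u}) : Prop :=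
  2 ≤ H.order ∧ H.order ≤ 2 * k ∧ H.order ≤ k + H.numComponents

theorem isSubgraphSum_e_bound (hiso : f.IsoInvariant) (hmonic : f.IsMonic)
    (hexp : f.ExponentialType) {k : ℕ} (hk : 1 ≤ k) :
    IsSubgraphSum (fun H => k + 1 ≤ H.order ∧ H.order ≤ 2 * k ∧ H.order ≤ k + H.numComponents)
      (f.e k) := by
  refine (isSubgraphSum_e hiso hexp hk).mono fun H ⟨h1, h2⟩ => ?_
  have h3 := coeff_core_ne_zero hiso hmonic hexp h2
  omega

theorem isSubgraphSum_p (hiso : f.IsoInvariant) (hmonic : f.IsMonic)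
    (hexp : f.ExponentialType) {k : ℕ} (hk : 1 ≤ k) :
    IsSubgraphSum (PowerSumBound k) (f.p k) := by
  have he : ∀ {i : ℕ}, 1 ≤ i → IsSubgraphSum (PowerSumBound i) (f.e i) := fun hi =>
    (isSubgraphSum_e_bound hiso hmonic hexp hi).mono fun H h => ⟨by omega, h.2⟩
  induction k using Nat.strong_induction_on with
  | _ k ih =>
    rw [p_eq hmonic hk]
    refine ((he hk).smul _).add (.sum fun a ha => .smul _ ?_)
    simp only [Finset.mem_filter, Finset.HasAntidiagonal.mem_antidiagonal, Set.mem_Ioo] at ha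
    -- Since `a.1 + a.2 = k`, subadditivity of order and rank adds the bounds for `K` and `L` to
    -- those for `k`; `|G| ≥ |K|` gives the lower bound.
    refine (he (by omega)).mul (ih a.2 (by omega) (by omega)) fun G K L hKL hK hL => ?_
    obtain ⟨h1, h2, h3⟩ := hK
    obtain ⟨h4, h5, h6⟩ := hL
    have h7 := order_le_add hKL
    have h8 := order_add_numComponents_le hKL
    have h9 := order_ofSubgraph_le K
    exact ⟨by omega, by omega, by omega⟩

theorem p_disjUnion (hmonic : f.IsMonic) (hmul : f.Multiplicative) (k : ℕ)
    (G₁ G₂ : FinGraph.{u}) : f.p k (G₁.disjUnion G₂) = f.p k G₁ + f.p k G₂ := by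
  simp only [p, hmul G₁ G₂]
  rw [roots_mul (mul_ne_zero (hmonic G₁).1.ne_zero (hmonic G₂).1.ne_zero), Multiset.map_add,
    Multiset.sum_add]

end GraphPolynomial

end

/-! ### The theorem. -/

theorem theorem5p4 (f : GraphPolynomial.{u}) (hiso : f.IsoInvariant) (hmonic : f.IsMonic)
    (hexp : f.ExponentialType) (k : ℕ) (hk : 1 ≤ k) :
    (f.e k ∈ FinGraph.countSpan {H : FinGraph.{u} | k + 1 ≤ H.order ∧ H.order ≤ 2 * k ∧
        (H.order : ℤ) - H.numComponents ≤ k} ∧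
      f.p k ∈ FinGraph.countSpan {H : FinGraph.{u} | 2 ≤ H.order ∧ H.order ≤ 2 * k ∧
        (H.order : ℤ) - H.numComponents ≤ k}) ∧
    (f.Multiplicative →
      f.e k ∈ FinGraph.countSpan {H : FinGraph.{u} | H.IsolateFree ∧
        (H.order : ℤ) - H.numComponents = k} ∧
      f.p k ∈ FinGraph.countSpan {H : FinGraph.{u} | H.graph.Connected ∧
        2 ≤ H.order ∧ H.order ≤ k + 1}) := by
  have hp := GraphPolynomial.isSubgraphSum_p hiso hmonic hexp hk
  refine ⟨⟨?_, ?_⟩, fun hmul => ⟨?_, ?_⟩⟩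
  · refine ((GraphPolynomial.isSubgraphSum_e_bound hiso hmonic hexp hk).mono fun H h => ?_).mem_countSpan
      (N := 2 * k) fun H h => h.2.1
    exact ⟨h.1, h.2.1, by omega⟩
  · refine (hp.mono fun H h => ?_).mem_countSpan (N := 2 * k) fun H h => h.2.1
    exact ⟨h.1, h.2.1, by have := h.2.2; omega⟩
  -- The bound `2 * k` is carried along only to supply the finiteness that `mem_countSpan` needs,
  -- and is dropped by monotonicity of the span.
  · have he : f.e k ∈ FinGraph.countSpan {H : FinGraph.{u} | (H.IsolateFree ∧
        (H.order : ℤ) - H.numComponents = k) ∧ H.order ≤ 2 * k} := by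
      refine ((GraphPolynomial.isSubgraphSum_e hiso hexp hk).mono fun H h => ?_).mem_countSpan
        (N := 2 * k) fun H h => h.2
      have h1 := GraphPolynomial.coeff_core_ne_zero hiso hmonic hexp h.2
      have h2 := GraphPolynomial.coeff_core_ne_zero_of_multiplicative hiso hmonic hexp hmul h.2
      exact ⟨⟨h2.1, by omega⟩, by omega⟩
    exact Submodule.span_mono (Set.image_mono fun H h => h.1) he
  -- Additivity leaves only connected graphs; with one component the rank bound reads `|H| - 1 ≤ k`.
  · refine ((hp.connected_of_additive (fun H h => by have := h.1; omega)
      (fun G H h => by simp only [GraphPolynomial.p, hiso G H h]) (GraphPolynomial.p_disjUnion hmonic hmul k)).mono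
      fun H h => ?_).mem_countSpan (N := k + 1) fun H h => h.2.2
    have h1 := FinGraph.numComponents_eq_one h.2
    obtain ⟨⟨h2, -, h3⟩, h4⟩ := h
    exact ⟨h4, h2, by omega⟩
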